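/- For a power $q$ of a prime, a positive integer $n$ coprime to $q$, an integer $\delta\ge 2$ and $m=\mathrm{ord}_n(q)$, let $\alpha\in\mathbb F_{q^m}$ be a primitive $n$-th root of unity and let $m_i(x)$ be the minimal polynomial of $\alpha^i$ over $\mathbb F_q$. The narrow-sense BCH code $\mathbf C_{(q,n,\delta,1)}$ is the cyclic code of length $n$ over $\mathbb F_q$ with generator polynomial $\mathrm{lcm}(m_1(x),m_2(x),\dots,m_{\delta-1}(x))$. A linear code over $\mathbb F_q$ has parameters $[n,k,d]_q$ if it is a $k$-dimensional subspace of $\mathbb F_q^n$ with minimum Hamming distance $d$. **Theorem 5.1.** Let $m\ge 8$ be an integer. For every choice of the primitive element $\alpha$ of $\mathbb F_{2^m}$ the following hold. - If $8\mid m$, then the binary BCH code $\mathbf C_{(2,2^m-1,9,1)}$ has parameters $[2^m-1,\,2^m-4m-1,\,9]_2$. - If $14\mid m$, then the binary BCH code $\mathbf C_{(2,2^m-1,15,1)}$ has parameters $[2^m-1,\,2^m-7m-1,\,15]_2$. -/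

import Mathlib

open Polynomial

noncomputable section

/-- The polynomial `c₀ + c₁ X + ⋯ + c_{n-1} X ^ (n-1)` of a word `c = (c₀, …, c_{n-1})`. -/
def wordPoly {F : Type*} [Field F] {n : ℕ} (c : Fin n → F) : F[X] :=
  ∑ i : Fin n, C (c i) * X ^ (i : ℕ)

/-- The cyclic code of length `n` over `F` with generator polynomial `g`, where `g ∣ X ^ n - 1`:
the words whose polynomial is a multiple of `g`. -/
def cyclicCode {F : Type*} [Field F] (n : ℕ) (g : F[X]) : Submodule F (Fin n → F) where
  carrier := {c | g ∣ wordPoly c}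
  zero_mem' := by simp [wordPoly]
  add_mem' := by
    intro a b ha hb
    have h : wordPoly (a + b) = wordPoly a + wordPoly b := by
      simp [wordPoly, add_mul, Finset.sum_add_distrib]
    rw [Set.mem_ofPred_eq, h]
    exact dvd_add ha hb
  smul_mem' := by
    intro r a ha
    have h : wordPoly (r • a) = C r * wordPoly a := by
      simp [wordPoly, Finset.mul_sum, mul_assoc]
    rw [Set.mem_ofPred_eq, h]
    exact Dvd.dvd.mul_left ha _

open scoped Classical in
/-- The monic least common multiple of the minimal polynomials over `F` of
`α, α ^ 2, …, α ^ (δ - 1)`. -/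
def bchGenerator (F : Type*) [Field F] {K : Type*} [Field K] [Algebra F K] (α : K) (δ : ℕ) :
    F[X] :=
  letI : StrongNormalizedGCDMonoid F[X] := UniqueFactorizationMonoid.toStrongNormalizedGCDMonoid F[X]
  (Finset.Icc 1 (δ - 1)).lcm fun i => minpoly F (α ^ i)

/-- The narrow-sense BCH code of length `n` and designed distance `δ` over `F`, formed with a
primitive `n`-th root of unity `α` in an extension field of `F`. -/
def bchCode (F : Type*) [Field F] {K : Type*} [Field K] [Algebra F K] (α : K) (n δ : ℕ) :
    Submodule F (Fin n → F) :=
  cyclicCode n (bchGenerator F α δ)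

/-- The number `d` is the minimum of the Hamming distances between two distinct words of `S`. -/
def IsMinDist {F : Type*} [DecidableEq F] {n : ℕ} (S : Set (Fin n → F)) (d : ℕ) : Prop :=
  IsLeast {e : ℕ | ∃ a ∈ S, ∃ b ∈ S, a ≠ b ∧ hammingDist a b = e} d

/-- The linear code `S` of length `n` over `F` has parameters `[n, k, d]`. -/
def HasParameters {F : Type*} [Field F] [DecidableEq F] {n : ℕ} (S : Submodule F (Fin n → F))
    (k d : ℕ) : Prop :=
  Module.finrank F S = k ∧ IsMinDist (S : Set (Fin n → F)) d

end

/-! Write the designed distance as 2t+1. The BCH bound gives d ≥ 2t+1, and the generator has degree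
tm because the odd numbers below 2t lie in distinct full 2-cyclotomic cosets
(`natDegree_bchGenerator`). It remains to find a word of weight 2t+1. Such a word is a set of 2t+1
nonzero locators in K whose power sums of orders 1 to 2t vanish. By Newton's identities in
characteristic 2 it suffices that the odd elementary symmetric functions up to order 2t vanish. The
locators are the roots of X^(2t+1) + X^3 + X + 1, which has no even powers except its constant term.
For t = 4 it divides X^(2^8) - X and for t = 7 it divides X^(2^7) - X, so it splits into distinct
factors over K. -/

theorem bchGenerator_dvd_iff {F : Type*} [Field F] {K : Type*} [Field K] [Algebra F K]
    {α : K} {δ : ℕ} {p : F[X]} :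
    bchGenerator F α δ ∣ p ↔ ∀ j ∈ Finset.Icc 1 (δ - 1), minpoly F (α ^ j) ∣ p := by
  unfold bchGenerator
  simp only [Finset.lcm_dvd_iff]

theorem mem_bchCode_iff {F : Type*} [Field F] {K : Type*} [Field K] [Algebra F K] {α : K}
    {n δ : ℕ} {c : Fin n → F} :
    c ∈ bchCode F α n δ ↔ ∀ j ∈ Finset.Icc 1 (δ - 1), aeval (α ^ j) (wordPoly c) = 0 := by
  change bchGenerator F α δ ∣ wordPoly c ↔ _
  simp only [bchGenerator_dvd_iff, minpoly.dvd_iff]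

theorem aeval_wordPoly {F : Type*} [Field F] {K : Type*} [Field K] [Algebra F K] {n : ℕ}
    (c : Fin n → F) (x : K) :
    aeval x (wordPoly c) = ∑ i, algebraMap F K (c i) * x ^ (i : ℕ) := by
  simp [wordPoly]

open Finset in
/-- The BCH bound. -/
theorem le_hammingNorm_of_mem_bchCode {F : Type*} [Field F] [DecidableEq F] {K : Type*} [Field K]
    [Algebra F K] {α : K} {n δ : ℕ} (hα : IsPrimitiveRoot α n) {c : Fin n → F}
    (hc : c ∈ bchCode F α n δ) (hc0 : c ≠ 0) : δ ≤ hammingNorm c := by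
  by_contra! hlt
  set S : Finset (Fin n) := univ.filter fun i => c i ≠ 0 with hS
  have hcard : #S < δ := hlt
  obtain ⟨i₀, hi₀⟩ : ∃ i, c i ≠ 0 := by
    by_contra! h
    exact hc0 (funext h)
  have hi₀S : i₀ ∈ S := by simp [hS, hi₀]
  have hn : n ≠ 0 := by
    rintro rfl
    exact i₀.elim0
  -- Combining the check equations with the coefficients of h isolates the term at i₀. The factor X
  -- removes the constant coefficient, since no check at exponent 0 is available.
  set h : K[X] := X * ∏ i ∈ S.erase i₀, (X - C (α ^ (i : ℕ))) with hh
  have hdeg : h.natDegree = #S := by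
    have hm : (∏ i ∈ S.erase i₀, (X - C (α ^ (i : ℕ)))).Monic :=
      monic_prod_of_monic _ _ fun i _ => monic_X_sub_C _
    rw [hh, Monic.natDegree_mul monic_X hm, natDegree_X, natDegree_prod_of_monic _ _
      fun i _ => monic_X_sub_C _]
    simp only [natDegree_X_sub_C, sum_const, smul_eq_mul, mul_one]
    rw [add_comm, card_erase_add_one hi₀S]
  have hzero : ∑ i, algebraMap F K (c i) * h.eval (α ^ (i : ℕ)) = 0 := by
    simp_rw [eval_eq_sum_range, mul_sum]
    rw [sum_comm]
    refine sum_eq_zero fun k hk => ?_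
    rcases Nat.eq_zero_or_pos k with rfl | hk0
    · simp [hh]
    · have := mem_bchCode_iff.1 hc k (mem_Icc.2 ⟨hk0, by rw [mem_range, hdeg] at hk; omega⟩)
      rw [aeval_wordPoly] at this
      rw [← mul_zero (h.coeff k), ← this, mul_sum]
      refine sum_congr rfl fun i _ => ?_
      rw [← pow_mul, ← pow_mul, mul_comm k]
      ring
  rw [sum_eq_single i₀] at hzero
  · rcases mul_eq_zero.1 hzero with h0 | h0
    · exact hi₀ (by simpa using h0)
    · rw [hh, eval_mul, eval_X, eval_prod] at h0
      rcases mul_eq_zero.1 h0 with h0 | h0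
      · exact hα.ne_zero hn (eq_zero_of_pow_eq_zero h0)
      · obtain ⟨i, hi, hi'⟩ := prod_eq_zero_iff.1 h0
        rw [eval_sub, eval_X, eval_C, sub_eq_zero] at hi'
        exact (mem_erase.1 hi).1 (Fin.ext (hα.pow_inj i₀.2 i.2 hi').symm)
  · intro i _ hi
    by_cases hci : c i = 0
    · simp [hci]
    · have : h.eval (α ^ (i : ℕ)) = 0 := by
        rw [hh, eval_mul, eval_prod, prod_eq_zero (i := i) (by simp [hS, hi, hci]) (by simp),
          mul_zero]
      rw [this, mul_zero]
  · simp

/-! ### Dimension: degree of the generator and cyclotomic cosets -/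

theorem finrank_cyclicCode {F : Type*} [Field F] {n : ℕ} {g : F[X]} (hg : g ≠ 0)
    (hn : g.natDegree ≤ n) : Module.finrank F (cyclicCode n g) = n - g.natDegree := by
  let φ : (Fin n → F) →ₗ[F] AdjoinRoot g :=
    { toFun := fun c => AdjoinRoot.mk g (wordPoly c)
      map_add' := fun a b => by
        rw [← map_add]
        congr 1
        simp [wordPoly, add_mul, Finset.sum_add_distrib]
      map_smul' := fun r a => by
        rw [RingHom.id_apply, AdjoinRoot.smul_mk]
        congr 1
        simp [wordPoly, Finset.smul_sum, smul_eq_C_mul, mul_assoc] }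
  have hker : LinearMap.ker φ = cyclicCode n g := by
    ext c
    exact AdjoinRoot.mk_eq_zero
  have hsurj : Function.Surjective φ := by
    intro y
    obtain ⟨p, rfl⟩ := AdjoinRoot.mk_surjective y
    refine ⟨fun i => (p % g).coeff i, ?_⟩
    change AdjoinRoot.mk g (wordPoly fun i : Fin n => (p % g).coeff i) = _
    have hword : (wordPoly fun i : Fin n => (p % g).coeff i) = p % g := by
      have hlt : p % g = 0 ∨ (p % g).natDegree < n := by
        by_cases h0 : p % g = 0
        · exact Or.inl h0
        · exact Or.inr (lt_of_lt_of_le (natDegree_lt_natDegree h0 (EuclideanDomain.mod_lt p hg)) hn)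
      rcases hlt with h0 | hlt
      · simp [h0, wordPoly]
      · exact (Fin.sum_univ_eq_sum_range (fun i => C ((p % g).coeff i) * X ^ i) n).trans
          ((p % g).as_sum_range_C_mul_X_pow' hlt).symm
    rw [hword, AdjoinRoot.mk_eq_mk]
    exact ⟨-(p / g), by linear_combination EuclideanDomain.mod_add_div p g⟩
  have hrank := φ.finrank_range_add_finrank_ker
  rw [hker, LinearMap.range_eq_top.2 hsurj, finrank_top, (AdjoinRoot.powerBasis hg).finrank,
    AdjoinRoot.powerBasis_dim, Module.finrank_fin_fun] at hrank
  omega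

theorem pow_two_pow_eq_self {K : Type*} [Field K] {m : ℕ} (hK : Nat.card K = 2 ^ m) (x : K) :
    x ^ 2 ^ m = x := by
  have : Finite K := Nat.finite_of_card_ne_zero (by rw [hK]; positivity)
  have := Fintype.ofFinite K
  rw [← hK, Nat.card_eq_fintype_card, FiniteField.pow_card]

/-- If i + s ≤ m, both exponents are below the order of α, hence equal, and parity forces i = 0.
Otherwise m - i < s, and m - i further Frobenius steps move the power of 2 to the side of k, where
parity gives a contradiction. -/
theorem odd_exponent_conjugate_unique {K : Type*} [Field K] {m s : ℕ} (hs : 1 ≤ s)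
    (hsm : 2 * s ≤ m) (hK : Nat.card K = 2 ^ m) {α : K} (hα : IsPrimitiveRoot α (2 ^ m - 1))
    {j k i : ℕ} (hj : j % 2 = 1) (hk : k % 2 = 1) (hjs : j < 2 ^ s) (hks : k < 2 ^ s) (hi : i < m)
    (h : α ^ (j * 2 ^ i) = α ^ k) : i = 0 ∧ j = k := by
  have hle : ∀ a e : ℕ, a < 2 ^ s → e + s ≤ m → e ≠ 0 → a * 2 ^ e < 2 ^ m - 1 := by
    intro a e ha he he0
    have h1 : (a + 1) * 2 ^ e ≤ 2 ^ s * 2 ^ e := Nat.mul_le_mul_right _ ha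
    have h2 : 2 ^ s * 2 ^ e ≤ 2 ^ m := by
      rw [← pow_add]
      exact Nat.pow_le_pow_right (by norm_num) (by omega)
    have h3 : 2 ^ 1 ≤ 2 ^ e := Nat.pow_le_pow_right (by norm_num) (by omega)
    rw [add_mul] at h1
    omega
  have hlt : ∀ a : ℕ, a < 2 ^ s → a % 2 = 1 → a < 2 ^ m - 1 := by
    intro a ha _
    have := hle a 1 ha (by omega) (by norm_num)
    omega
  have hpow : ∀ e : ℕ, e ≠ 0 → ∃ b, 2 ^ e = 2 * b := fun e he =>
    ⟨2 ^ (e - 1), by rw [← pow_succ', Nat.sub_add_cancel (by omega)]⟩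
  rcases Nat.eq_zero_or_pos i with rfl | hi0
  · exact ⟨rfl, hα.pow_inj (hlt j hjs hj) (hlt k hks hk) (by simpa using h)⟩
  exfalso
  rcases le_or_gt (i + s) m with his | his
  · have := hα.pow_inj (hle j i hjs his (by omega)) (hlt k hks hk) h
    obtain ⟨b, hb⟩ := hpow i (by omega)
    rw [hb, mul_left_comm] at this
    omega
  · have h' : α ^ j = α ^ (k * 2 ^ (m - i)) := by
      rw [pow_mul α k, ← h, ← pow_mul, mul_assoc, ← pow_add, Nat.add_sub_cancel' hi.le, pow_mul,
        pow_two_pow_eq_self hK]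
    have := hα.pow_inj (hlt j hjs hj) (hle k (m - i) hks (by omega) (by omega)) h'
    obtain ⟨b, hb⟩ := hpow (m - i) (by omega)
    rw [hb, mul_left_comm] at this
    omega

theorem charP_two_of_algebra (K : Type*) [Field K] [Algebra (ZMod 2) K] : CharP K 2 :=
  charP_of_injective_algebraMap (algebraMap (ZMod 2) K).injective 2

theorem odd_exponent_conjugates_injective {K : Type*} [Field K] [Algebra (ZMod 2) K] {m s t : ℕ}
    (hs : 1 ≤ s) (hsm : 2 * s ≤ m) (hts : 2 * t ≤ 2 ^ s) (hK : Nat.card K = 2 ^ m) {α : K}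
    (hα : IsPrimitiveRoot α (2 ^ m - 1)) :
    Function.Injective fun p : Fin t × Fin m => α ^ ((2 * (p.1 : ℕ) + 1) * 2 ^ (p.2 : ℕ)) := by
  have : CharP K 2 := charP_two_of_algebra K
  have key : ∀ a b : Fin t, ∀ i k : Fin m, k ≤ i →
      α ^ ((2 * (a : ℕ) + 1) * 2 ^ (i : ℕ)) = α ^ ((2 * (b : ℕ) + 1) * 2 ^ (k : ℕ)) →
      (a, i) = (b, k) := by
    intro a b i k hki h
    have h' : α ^ ((2 * (a : ℕ) + 1) * 2 ^ ((i : ℕ) - k)) = α ^ (2 * (b : ℕ) + 1) := by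
      apply iterateFrobenius_inj K 2 k
      rw [iterateFrobenius_def, iterateFrobenius_def, ← pow_mul, ← pow_mul, ← h, mul_assoc,
        ← pow_add, Nat.sub_add_cancel hki]
    obtain ⟨h1, h2⟩ := odd_exponent_conjugate_unique hs hsm hK hα (by omega) (by omega)
      (by omega) (by omega) (by omega) h'
    have hki' : (k : ℕ) ≤ i := hki
    rw [Prod.mk.injEq]
    exact ⟨Fin.ext (by omega), Fin.ext (by omega)⟩
  rintro ⟨a, i⟩ ⟨b, k⟩ h
  rcases le_total k i with hki | hik
  · exact key a b i k hki h
  · exact (key b a k i hik h.symm).symm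

theorem aeval_pow_two_pow {K : Type*} [Field K] [Algebra (ZMod 2) K] (p : (ZMod 2)[X]) (x : K)
    (i : ℕ) : aeval (x ^ 2 ^ i) p = aeval x p ^ 2 ^ i := by
  induction i with
  | zero => simp
  | succ i ih =>
    rw [pow_succ, pow_mul, pow_mul, ← ih, ← map_pow, ← ZMod.expand_card, expand_aeval]

open Finset in
theorem natDegree_bchGenerator {K : Type*} [Field K] [Algebra (ZMod 2) K] {m s t : ℕ}
    (hs : 1 ≤ s) (hsm : 2 * s ≤ m) (hts : 2 * t ≤ 2 ^ s) (hK : Nat.card K = 2 ^ m) {α : K}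
    (hα : IsPrimitiveRoot α (2 ^ m - 1)) :
    bchGenerator (ZMod 2) α (2 * t + 1) ≠ 0 ∧
      (bchGenerator (ZMod 2) α (2 * t + 1)).natDegree = t * m := by
  classical
  have : Finite K := Nat.finite_of_card_ne_zero (by rw [hK]; positivity)
  have hfin : Module.finrank (ZMod 2) K = m := by
    have := Module.natCard_eq_pow_finrank (K := ZMod 2) (V := K)
    rw [hK, Nat.card_zmod] at this
    exact (Nat.pow_right_injective le_rfl this).symm
  have hint : ∀ x : K, IsIntegral (ZMod 2) x := fun x => Algebra.IsIntegral.isIntegral x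
  -- Odd exponents suffice: a root at α^u is also a root at α^(2^e u). This bounds the degree above
  -- by tm; the tm distinct conjugates in R bound it below.
  set P : (ZMod 2)[X] := ∏ a : Fin t, minpoly (ZMod 2) (α ^ (2 * (a : ℕ) + 1)) with hP
  have hP0 : P ≠ 0 := prod_ne_zero_iff.2 fun a _ => minpoly.ne_zero (hint _)
  have hdvd : bchGenerator (ZMod 2) α (2 * t + 1) ∣ P := by
    refine bchGenerator_dvd_iff.2 fun j hj => minpoly.dvd _ _ ?_
    rw [mem_Icc] at hj
    obtain ⟨e, u, hu, rfl⟩ := Nat.exists_eq_two_pow_mul_odd (n := j) (by omega)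
    obtain ⟨b, rfl⟩ := hu
    have hb : 2 * b + 1 ≤ 2 ^ e * (2 * b + 1) := Nat.le_mul_of_pos_left _ (by positivity)
    rw [mul_comm, pow_mul, aeval_pow_two_pow, hP, map_prod,
      prod_eq_zero (mem_univ (⟨b, by omega⟩ : Fin t)) (minpoly.aeval _ _),
      zero_pow (by positivity)]
  set g := bchGenerator (ZMod 2) α (2 * t + 1) with hg
  have hg0 : g ≠ 0 := ne_zero_of_dvd_ne_zero hP0 hdvd
  refine ⟨hg0, le_antisymm ?_ ?_⟩
  · calc g.natDegree ≤ P.natDegree := natDegree_le_of_dvd hdvd hP0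
      _ ≤ ∑ a : Fin t, (minpoly (ZMod 2) (α ^ (2 * (a : ℕ) + 1))).natDegree :=
        natDegree_prod_le _ _
      _ ≤ ∑ _a : Fin t, m := sum_le_sum fun a _ => hfin ▸ minpoly.natDegree_le _
      _ = t * m := by simp
  · set R : Finset K := univ.image fun p : Fin t × Fin m =>
      α ^ ((2 * (p.1 : ℕ) + 1) * 2 ^ (p.2 : ℕ)) with hR
    have hRcard : #R = t * m := by
      rw [hR, card_image_of_injective _ (odd_exponent_conjugates_injective hs hsm hts hK hα)]
      simp
    have hmap0 : g.map (algebraMap (ZMod 2) K) ≠ 0 := by simpa using hg0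
    have hroots : R.val ⊆ (g.map (algebraMap (ZMod 2) K)).roots := by
      intro x hx
      obtain ⟨⟨a, i⟩, _, rfl⟩ := mem_image.1 (mem_def.2 hx)
      rw [mem_roots hmap0, IsRoot, eval_map_algebraMap, pow_mul, aeval_pow_two_pow,
        aeval_eq_zero_of_dvd_aeval_eq_zero (bchGenerator_dvd_iff.1 dvd_rfl _ ?_) (minpoly.aeval _ _),
        zero_pow (by positivity)]
      exact mem_Icc.2 ⟨by omega, by omega⟩
    rw [← hRcard, ← natDegree_map (algebraMap (ZMod 2) K) (p := g)]
    exact card_le_degree_of_subset_roots hroots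

/-! ### Words of minimum weight from locators -/

open Finset in
/-- By Newton's identities, the first power sums of the roots of a monic split polynomial over a
field of characteristic two vanish if its odd elementary symmetric functions do. -/
theorem sum_roots_pow_eq_zero {K : Type*} [Field K] [CharP K 2] {S : Finset K} {t : ℕ}
    (hS : ∀ k, k % 2 = 1 → k ≤ 2 * t → S.val.esymm k = 0) {k : ℕ} (hk0 : 0 < k)
    (hk : k ≤ 2 * t) : ∑ x ∈ S, x ^ k = 0 := by
  induction k using Nat.strong_induction_on with
  | _ k ih =>
    have h := congrArg (MvPolynomial.aeval fun x : S => (x : K))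
      (MvPolynomial.psum_eq_mul_esymm_sub_sum S K k hk0)
    have hval : (univ : Finset S).val.map (fun x : S => (x : K)) = S.val := by
      simpa using congrArg Finset.val (attach_map_val (s := S))
    have hpsum : ∀ l, MvPolynomial.aeval (fun x : S => (x : K)) (MvPolynomial.psum S K l) =
        ∑ x ∈ S, x ^ l := fun l => by
      simp only [MvPolynomial.psum, map_sum, map_pow, MvPolynomial.aeval_X]
      exact sum_coe_sort S fun x => x ^ l
    simp only [map_sub, map_mul, map_sum, map_pow, map_neg, map_one, map_natCast, hpsum,
      MvPolynomial.aeval_esymm_eq_multiset_esymm, hval] at h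
    have h1 : (k : K) * S.val.esymm k = 0 := by
      -- In Newton's term k·e_k, the factor k vanishes for even k and e_k for odd k.
      rcases Nat.mod_two_eq_zero_or_one k with h2 | h2
      · rw [(CharP.cast_eq_zero_iff K 2 k).2 (Nat.dvd_of_mod_eq_zero h2), zero_mul]
      · rw [hS k h2 hk, mul_zero]
    rw [h, mul_assoc, h1, mul_zero, zero_sub, neg_eq_zero]
    refine sum_eq_zero fun a ha => ?_
    simp only [mem_filter, HasAntidiagonal.mem_antidiagonal, Set.mem_Ioo] at ha
    rw [ih a.2 (by omega) (by omega) (by omega), mul_zero]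

theorem aeval_word_of_finset {K : Type*} [Field K] [Algebra (ZMod 2) K] [DecidableEq K] {n : ℕ}
    [NeZero n] {α : K} (hα : IsPrimitiveRoot α n) {S : Finset K} (hS : ∀ x ∈ S, x ^ n = 1)
    (j : ℕ) :
    aeval (α ^ j) (wordPoly fun i : Fin n => if α ^ (i : ℕ) ∈ S then (1 : ZMod 2) else 0) =
      ∑ x ∈ S, x ^ j := by
  rw [aeval_wordPoly]
  simp only [apply_ite (algebraMap (ZMod 2) K), map_one, map_zero, ite_mul, one_mul, zero_mul]
  rw [← Finset.sum_filter]
  refine Finset.sum_nbij (fun i => α ^ (i : ℕ)) (fun i hi => by simpa using hi) ?_ ?_ ?_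
  · intro a _ b _ h
    exact Fin.ext (hα.pow_inj a.2 b.2 h)
  · intro x hx
    obtain ⟨i, hi, rfl⟩ := hα.eq_pow_of_pow_eq_one (hS x hx)
    exact ⟨⟨i, hi⟩, by simpa using hx, rfl⟩
  · intro i _
    rw [← pow_mul, ← pow_mul, mul_comm]

theorem hammingNorm_word_of_finset {K : Type*} [Field K] [DecidableEq K] {n : ℕ}
    [NeZero n] {α : K} (hα : IsPrimitiveRoot α n) {S : Finset K} (hS : ∀ x ∈ S, x ^ n = 1) :
    hammingNorm (fun i : Fin n => if α ^ (i : ℕ) ∈ S then (1 : ZMod 2) else 0) = S.card := by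
  unfold hammingNorm
  refine Finset.card_nbij (fun i => α ^ (i : ℕ)) (fun i hi => by simpa using hi) ?_ ?_
  · intro a _ b _ h
    exact Fin.ext (hα.pow_inj a.2 b.2 h)
  · intro x hx
    obtain ⟨i, hi, rfl⟩ := hα.eq_pow_of_pow_eq_one (hS x hx)
    exact ⟨⟨i, hi⟩, by simpa using hx, rfl⟩

/-- The parameters of a narrow-sense primitive binary BCH code, given the supporting locators of a
word whose weight is the designed distance. -/
theorem bchCode_hasParameters {K : Type*} [Field K] [Algebra (ZMod 2) K] {m s t : ℕ}
    (hs : 1 ≤ s) (hsm : 2 * s ≤ m) (hts : 2 * t ≤ 2 ^ s) (htm : t * m ≤ 2 ^ m - 1)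
    (hK : Nat.card K = 2 ^ m) {α : K} (hα : IsPrimitiveRoot α (2 ^ m - 1)) {S : Finset K}
    (hS0 : (0 : K) ∉ S) (hcard : S.card = 2 * t + 1)
    (hS : ∀ k, 0 < k → k ≤ 2 * t → ∑ x ∈ S, x ^ k = 0) :
    HasParameters (bchCode (ZMod 2) α (2 ^ m - 1) (2 * t + 1)) (2 ^ m - t * m - 1)
      (2 * t + 1) := by
  classical
  have hm2 : 2 ^ 2 ≤ 2 ^ m := Nat.pow_le_pow_right (by norm_num) (by omega)
  have : NeZero (2 ^ m - 1) := ⟨by omega⟩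
  obtain ⟨hg0, hdeg⟩ := natDegree_bchGenerator hs hsm hts hK hα
  refine ⟨?_, ?_, ?_⟩
  · rw [bchCode, finrank_cyclicCode hg0 (hdeg ▸ htm), hdeg]
    omega
  · have hS1 : ∀ x ∈ S, x ^ (2 ^ m - 1) = 1 := fun x hx => by
      have hx0 : x ≠ 0 := fun h => hS0 (h ▸ hx)
      apply mul_right_cancel₀ hx0
      rw [one_mul, ← pow_succ, Nat.sub_add_cancel (by omega), pow_two_pow_eq_self hK]
    refine ⟨fun i => if α ^ (i : ℕ) ∈ S then 1 else 0, mem_bchCode_iff.2 fun j hj => ?_, 0,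
      zero_mem _, ?_, ?_⟩
    · rw [Finset.mem_Icc] at hj
      rw [aeval_word_of_finset hα hS1]
      exact hS j (by omega) (by omega)
    · rw [← hammingNorm_ne_zero_iff, hammingNorm_word_of_finset hα hS1]
      omega
    · rw [hammingDist_zero_right, hammingNorm_word_of_finset hα hS1, hcard]
  · rintro e ⟨a, ha, b, hb, hab, rfl⟩
    have hmem : -a + b ∈ bchCode (ZMod 2) α (2 ^ m - 1) (2 * t + 1) :=
      Submodule.add_mem _ (Submodule.neg_mem _ (SetLike.mem_coe.1 ha)) (SetLike.mem_coe.1 hb)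
    have hle := le_hammingNorm_of_mem_bchCode hα hmem fun h => hab (neg_add_eq_zero.1 h)
    rwa [← hammingDist_eq_hammingNorm] at hle

theorem dvd_X_pow_sub_X_of_root {K : Type*} [Field K] {f : K[X]} {q : ℕ}
    (h : AdjoinRoot.root f ^ q = AdjoinRoot.root f) : f ∣ X ^ q - X := by
  rw [← AdjoinRoot.mk_eq_zero]
  simpa [sub_eq_zero] using h

open Finset in
/-- A polynomial with zero even coefficients apart from the constant one which divides
`X ^ 2 ^ r - X` yields locators with vanishing power sums. -/
theorem exists_locators {K : Type*} [Field K] [CharP K 2] {m r t : ℕ} (hrm : r ∣ m)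
    (hm : m ≠ 0) (hK : Nat.card K = 2 ^ m) {f : K[X]} (hdeg : f.natDegree = 2 * t + 1)
    (heven : ∀ k, k % 2 = 0 → k ≠ 0 → f.coeff k = 0) (hf0 : f.coeff 0 ≠ 0) (hmonic : f.Monic)
    (hdvd : f ∣ X ^ 2 ^ r - X) :
    ∃ S : Finset K, (0 : K) ∉ S ∧ #S = 2 * t + 1 ∧
      ∀ k, 0 < k → k ≤ 2 * t → ∑ x ∈ S, x ^ k = 0 := by
  classical
  have : Finite K := Nat.finite_of_card_ne_zero (by rw [hK]; positivity)
  have := Fintype.ofFinite K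
  have hcardK : Fintype.card K = 2 ^ m := by rw [← Nat.card_eq_fintype_card, hK]
  have hq : (X ^ 2 ^ m - X : K[X]) ≠ 0 :=
    FiniteField.X_pow_card_sub_X_ne_zero K (Nat.one_lt_two_pow hm)
  have hdvd' : f ∣ X ^ 2 ^ m - X := hdvd.trans (dvd_pow_pow_sub_self_of_dvd hrm)
  have hqroots : (X ^ 2 ^ m - X : K[X]).roots = univ.val := by
    rw [← hcardK, FiniteField.roots_X_pow_card_sub_X]
  have hqs : (X ^ 2 ^ m - X : K[X]).Splits := by
    rw [splits_iff_card_roots, hqroots,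
      FiniteField.X_pow_card_sub_X_natDegree_eq K (Nat.one_lt_two_pow hm), ← hcardK]
    rfl
  have hsplit : f.Splits := hqs.of_dvd hq hdvd'
  have hnodup : f.roots.Nodup :=
    Multiset.nodup_of_le (roots.le_of_dvd hq hdvd') (hqroots ▸ univ.nodup)
  have hcard : f.roots.card = f.natDegree := splits_iff_card_roots.1 hsplit
  refine ⟨⟨f.roots, hnodup⟩, ?_, hcard.trans hdeg, fun k hk0 hk =>
    sum_roots_pow_eq_zero (fun l hl hlt => ?_) hk0 hk⟩
  · rw [mem_mk, mem_roots hmonic.ne_zero, IsRoot, ← coeff_zero_eq_eval_zero]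
    exact hf0
  · have h := coeff_eq_esymm_roots_of_card hcard (k := f.natDegree - l) (Nat.sub_le _ _)
    -- The degree and l are both odd, so the index is even; it is nonzero because l ≤ 2t.
    rw [heven _ (by omega) (by omega), hmonic, one_mul, Nat.sub_sub_self (by omega)] at h
    rcases mul_eq_zero.1 h.symm with h | h
    · exact absurd h (pow_ne_zero _ (neg_ne_zero.2 one_ne_zero))
    · exact h

/-! ### The two quadrinomials -/

/-- Repeated squaring modulo the quadrinomial: multiples of `h'` reduce degrees below 9, and
multiples of `h2` absorb cross terms and repeated monomials. -/
theorem pow_two_pow_eight_eq_self {R : Type*} [CommRing R] (h2 : (2 : R) = 0) {z : R}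
    (h : z ^ 9 + z ^ 3 + z + 1 = 0) : z ^ 2 ^ 8 = z := by
  have h' : z ^ 9 - z ^ 3 - z - 1 = 0 := by linear_combination h - (z ^ 3 + z + 1) * h2
  have h4 : z ^ 2 ^ 4 = z + z ^ 2 + z ^ 4 + z ^ 7 + z ^ 8 := by
    linear_combination (z + z ^ 7) * h'
  have h5 : z ^ 2 ^ 5 = z + z ^ 5 + z ^ 6 + z ^ 7 + z ^ 8 := by
    rw [pow_succ 2 4, pow_mul, h4]
    linear_combination (z + z ^ 5 + z ^ 7) * h' + (z ^ 2 + z ^ 3 + z ^ 4 + z ^ 5 + z ^ 6 +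
      2 * z ^ 8 + 2 * z ^ 9 + z ^ 10 + z ^ 11 + z ^ 12 + z ^ 15) * h2
  have h6 : z ^ 2 ^ 6 = z ^ 2 + z ^ 3 + z ^ 4 + z ^ 5 + z ^ 7 := by
    rw [pow_succ 2 5, pow_mul, h5]
    linear_combination (z ^ 3 + z ^ 5 + z ^ 7) * h' + (2 * z ^ 6 + z ^ 7 + 2 * z ^ 8 + z ^ 9 +
      z ^ 10 + z ^ 11 + z ^ 12 + 2 * z ^ 13 + z ^ 14 + z ^ 15) * h2
  have h7 : z ^ 2 ^ 7 = z + z ^ 2 + z ^ 5 := by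
    rw [pow_succ 2 6, pow_mul, h6]
    linear_combination (z + z ^ 5) * h' + (z ^ 4 + z ^ 5 + 2 * z ^ 6 + 2 * z ^ 7 + 2 * z ^ 8 +
      2 * z ^ 9 + z ^ 10 + z ^ 11 + z ^ 12) * h2
  rw [pow_succ 2 7, pow_mul, h7]
  linear_combination z * h' + (z ^ 3 + z ^ 4 + z ^ 6 + z ^ 7 + z ^ 2) * h2

/-- Multiplying by z gives the linearized relation z^16 = z^4 + z^2 + z. Its associate x^4 + x^2 + x
+ 1 = (x + 1)(x^3 + x^2 + 1) divides x^7 - 1 over the field of two elements. -/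
theorem pow_two_pow_seven_eq_self {R : Type*} [CommRing R] (h2 : (2 : R) = 0) {z : R}
    (h : z ^ 15 + z ^ 3 + z + 1 = 0) : z ^ 2 ^ 7 = z := by
  have h4 : z ^ 2 ^ 4 = z + z ^ 2 + z ^ 4 := by
    linear_combination z * h - (z + z ^ 2 + z ^ 4) * h2
  have h5 : z ^ 2 ^ 5 = z ^ 2 + z ^ 4 + z ^ 8 := by
    rw [pow_succ 2 4, pow_mul, h4]
    linear_combination (z ^ 3 + z ^ 5 + z ^ 6) * h2
  have h6 : z ^ 2 ^ 6 = z + z ^ 2 + z ^ 8 := by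
    rw [pow_succ 2 5, pow_mul, h5]
    linear_combination h4 + (z ^ 4 + z ^ 6 + z ^ 10 + z ^ 12) * h2
  rw [pow_succ 2 6, pow_mul, h6]
  linear_combination h4 + (z ^ 2 + z ^ 4 + z ^ 3 + z ^ 9 + z ^ 10) * h2

/-- `hpow` ranges over rings because it is applied to the generic root in `AdjoinRoot`; the
quadrinomial vanishes at 1, so that quotient is not a field. -/
theorem exists_locators_of_quadrinomial.{u} {K : Type u} [Field K] [CharP K 2] {m r t : ℕ} (ht : 2 ≤ t)
    (hrm : r ∣ m) (hm : m ≠ 0) (hK : Nat.card K = 2 ^ m)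
    (hpow : ∀ {R : Type u} [CommRing R], (2 : R) = 0 → ∀ {z : R}, z ^ (2 * t + 1) + z ^ 3 + z + 1 = 0 →
      z ^ 2 ^ r = z) :
    ∃ S : Finset K, (0 : K) ∉ S ∧ S.card = 2 * t + 1 ∧
      ∀ k, 0 < k → k ≤ 2 * t → ∑ x ∈ S, x ^ k = 0 := by
  have hlow : (X ^ 3 + X + 1 : K[X]).degree < (2 * t + 1 : ℕ) := by
    have : (X ^ 3 + X + 1 : K[X]).degree ≤ 3 := by compute_degree
    exact this.trans_lt (by exact_mod_cast (by omega : 3 < 2 * t + 1))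
  have heq : (X ^ (2 * t + 1) + X ^ 3 + X + 1 : K[X]) = X ^ (2 * t + 1) + (X ^ 3 + X + 1) := by
    ring
  refine exists_locators (f := X ^ (2 * t + 1) + X ^ 3 + X + 1) hrm hm hK ?_ ?_ ?_ ?_ ?_
  · rw [heq]
    rw [natDegree_add_eq_left_of_degree_lt (by rwa [degree_X_pow]), natDegree_X_pow]
  · intro k hk hk0
    simp only [coeff_add, coeff_X_pow, coeff_X, coeff_one]
    rw [if_neg (by omega), if_neg (by omega), if_neg (by omega), if_neg (by omega)]
    simp
  · simp [coeff_X_pow, coeff_one]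
  · rw [heq]
    exact monic_X_pow_add hlow
  · refine dvd_X_pow_sub_X_of_root (hpow ?_ ?_)
    · have h := congrArg (algebraMap K (AdjoinRoot (X ^ (2 * t + 1) + X ^ 3 + X + 1 : K[X])))
        (CharTwo.two_eq_zero (R := K))
      rwa [map_ofNat, map_zero] at h
    · have h := AdjoinRoot.mk_self (f := (X ^ (2 * t + 1) + X ^ 3 + X + 1 : K[X]))
      rwa [map_add, map_add, map_add, map_pow, map_pow, AdjoinRoot.mk_X, map_one] at h

/-- Here `K` is the field with `2 ^ m` elements and `α` any of its primitive elements. The length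
`2 ^ m - 1` of the codes is part of their type. -/
theorem theorem5p1 {K : Type*} [Field K] [Algebra (ZMod 2) K] (m : ℕ) (hm : 8 ≤ m)
    (hK : Nat.card K = 2 ^ m) (α : K) (hα : IsPrimitiveRoot α (2 ^ m - 1)) :
    (8 ∣ m → HasParameters (bchCode (ZMod 2) α (2 ^ m - 1) 9) (2 ^ m - 4 * m - 1) 9) ∧
    (14 ∣ m → HasParameters (bchCode (ZMod 2) α (2 ^ m - 1) 15) (2 ^ m - 7 * m - 1) 15) := by
  have : CharP K 2 := charP_two_of_algebra K
  -- Makes the generator degree at most the length in both cases.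
  have hbound : 7 * m + 1 ≤ 2 ^ m := by
    clear hK hα
    induction m, hm using Nat.le_induction with
    | base => norm_num
    | succ m hm ih =>
      rw [pow_succ]
      omega
  refine ⟨fun h => ?_, fun h => ?_⟩
  · obtain ⟨S, hS0, hcard, hS⟩ := exists_locators_of_quadrinomial (t := 4) (r := 8) (by norm_num)
      h (by omega) hK pow_two_pow_eight_eq_self
    exact bchCode_hasParameters (s := 3) (t := 4) (by norm_num) (by omega) (by norm_num)
      (by omega) hK hα hS0 hcard hS
  -- The locators already lie in the field of 2^7 elements, so 7 ∣ m suffices.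
  · obtain ⟨S, hS0, hcard, hS⟩ := exists_locators_of_quadrinomial (t := 7) (r := 7) (by norm_num)
      ((by norm_num : 7 ∣ 14).trans h) (by omega) hK pow_two_pow_seven_eq_self
    exact bchCode_hasParameters (s := 4) (t := 7) (by norm_num) (by omega) (by norm_num)
      (by omega) hK hα hS0 hcard hS
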